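/- Let $\mathcal D$ be the collection of dyadic intervals $[k2^{-j},(k+1)2^{-j})$, $j,k\in\mathbb Z$, of the real line. For $L\in\mathcal D$ and $m\in\mathbb N=\{0,1,2,\dots\}$ let $\mathcal D_m(L)$ be the set of dyadic subintervals of $L$ of length $2^{-m}|L|$, and let $h_I=|I|^{-1/2}(\chi_{I_+}-\chi_{I_-})$ be the Haar function of $I\in\mathcal D$, where $I_+$ and $I_-$ are the right and left halves of $I$. Write $m_If=\frac1{|I|}\int_I f(x)\,dx$. A weight is a locally integrable function $w:\mathbb R\to\mathbb R$ that is positive almost everywhere. For $s\in\mathbb R$ and $q>1$, a weight $w$ belongs to $C^d_s$, respectively a weight $v$ belongs to $A^d_q$, if $$[w]_{C^d_s}:=\sup_{I\in\mathcal D}(m_Iw^s)(m_Iw)^{-s}<\infty,\qquad\text{respectively}\qquad [v]_{A^d_q}:=\sup_{I\in\mathcal D}(m_Iv)\bigl(m_Iv^{-1/(q-1)}\bigr)^{q-1}<\infty .$$ For every $q>1$ there is a constant $C_q>0$, depending only on $q$, such that the following holds. Let $t\in\mathbb R$, let $w$ be a weight in $C^d_{2t}$ such that $w^{2t}\in A^d_q$,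 and let $m,n\in\mathbb N$. Then for every $f\in L^2(\mathbb R)$ (complex-valued) the series over $L\in\mathcal D$ $$T^{m,n}_{t,w}f(x)=\sum_{L\in\mathcal D}\ \sum_{I\in\mathcal D_m(L),\,J\in\mathcal D_n(L)}\frac{\sqrt{|I|\,|J|}}{|L|}\,\frac{w(x)^t}{(m_Lw)^t}\,\langle f,h_I\rangle\,h_J(x),$$ whose summand for each $L$ is a finite sum and lies in $L^2(\mathbb R)$, converges unconditionally in $L^2(\mathbb R)$. It defines a bounded linear operator $T^{m,n}_{t,w}$ on $L^2(\mathbb R)$ (the $t$-Haar multiplier of complexity $(m,n)$), and $$\|T^{m,n}_{t,w}\|_{L^2\to L^2}\le C_q\,(m+n+2)^3\,[w]_{C^d_{2t}}^{1/2}\,[w^{2t}]_{A^d_q}^{1/2}.$$ -/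

import Mathlib

open MeasureTheory

noncomputable section

namespace DyadicHaar

/-- The index `(j, k)` of the dyadic interval `[k 2⁻ʲ, (k+1) 2⁻ʲ)` of the real line. -/
@[ext]
structure DyadicInterval where
  scale : ℤ
  pos : ℤ

namespace DyadicInterval

/-- The length `|I| = 2⁻ʲ`. -/
def len (I : DyadicInterval) : ℝ := (2 : ℝ) ^ (-I.scale)

/-- The interval itself, as a set of real numbers. -/
def toSet (I : DyadicInterval) : Set ℝ :=
  Set.Ico ((I.pos : ℝ) * I.len) (((I.pos : ℝ) + 1) * I.len)

/-- The left half `I₋`. -/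
def left (I : DyadicInterval) : DyadicInterval := ⟨I.scale + 1, 2 * I.pos⟩

/-- The right half `I₊`. -/
def right (I : DyadicInterval) : DyadicInterval := ⟨I.scale + 1, 2 * I.pos + 1⟩

/-- `𝒟_m(L)`: the dyadic subintervals of `L` of length `2⁻ᵐ |L|`
(see `mem_descendants`). -/
def descendants (m : ℕ) (L : DyadicInterval) : Finset DyadicInterval :=
  (Finset.Ico (L.pos * 2 ^ m) ((L.pos + 1) * 2 ^ m)).map
    ⟨DyadicInterval.mk (L.scale + m), fun _ _ h => congrArg DyadicInterval.pos h⟩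

theorem len_pos (I : DyadicInterval) : 0 < I.len := by
  unfold len; positivity

/-- Different indices give different intervals. -/
theorem toSet_injective : Function.Injective toSet := by
  intro I J h
  have hI := I.len_pos
  have hJ := J.len_pos
  have hlt : (I.pos : ℝ) * I.len < ((I.pos : ℝ) + 1) * I.len := by nlinarith
  have hlt' : (J.pos : ℝ) * J.len < ((J.pos : ℝ) + 1) * J.len := by nlinarith
  have h1 := (Set.Ico_subset_Ico_iff hlt).1 h.le
  have h2 := (Set.Ico_subset_Ico_iff hlt').1 h.ge
  have e : I.len = J.len := by linarith [h1.1, h1.2, h2.1, h2.2]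
  have hs : I.scale = J.scale := by
    have := zpow_right_injective₀ (a := (2 : ℝ)) (by norm_num) (by norm_num) e
    simpa using this
  have hp : (I.pos : ℝ) * I.len = (J.pos : ℝ) * I.len := by
    have := h1.1; have := h2.1; rw [← e] at *; linarith
  have hp' := mul_right_cancel₀ hI.ne' hp
  ext
  · exact hs
  · exact_mod_cast hp'

theorem mem_descendants {m : ℕ} {L I : DyadicInterval} :
    I ∈ L.descendants m ↔ I.toSet ⊆ L.toSet ∧ I.len = (2 : ℝ) ^ (-(m : ℤ)) * L.len := by
  have key : I.len = (2 : ℝ) ^ (-(m : ℤ)) * L.len ↔ I.scale = L.scale + m := by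
    unfold len
    rw [← zpow_add₀ (by norm_num)]
    constructor
    · intro h
      have := zpow_right_injective₀ (a := (2 : ℝ)) (by norm_num) (by norm_num) h
      linarith
    · intro h
      rw [h]
      congr 1
      ring
  rw [key]
  have hI := I.len_pos
  have hlt : (I.pos : ℝ) * I.len < ((I.pos : ℝ) + 1) * I.len := by nlinarith
  have hsub : I.scale = L.scale + m →
      (I.toSet ⊆ L.toSet ↔ L.pos * 2 ^ m ≤ I.pos ∧ I.pos + 1 ≤ (L.pos + 1) * 2 ^ m) := by
    intro h
    have hL : L.len = 2 ^ m * I.len := by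
      rw [key.2 h, ← mul_assoc, zpow_neg, zpow_natCast, mul_inv_cancel₀ (by positivity), one_mul]
    unfold toSet
    rw [Set.Ico_subset_Ico_iff hlt, hL, ← mul_assoc, ← mul_assoc,
      mul_le_mul_iff_left₀ hI, mul_le_mul_iff_left₀ hI]
    norm_cast
  have hmem : I ∈ L.descendants m ↔
      I.scale = L.scale + m ∧ L.pos * 2 ^ m ≤ I.pos ∧ I.pos + 1 ≤ (L.pos + 1) * 2 ^ m := by
    unfold descendants
    rw [Finset.mem_map]
    constructor
    · rintro ⟨k, hk, rfl⟩
      exact ⟨rfl, (Finset.mem_Ico.1 hk).1, (Finset.mem_Ico.1 hk).2⟩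
    · rintro ⟨h1, h2, h3⟩
      refine ⟨I.pos, Finset.mem_Ico.2 ⟨h2, h3⟩, ?_⟩
      ext
      · exact h1.symm
      · rfl
  rw [hmem]
  exact ⟨fun h => ⟨(hsub h.1).2 h.2, h.1⟩, fun h => ⟨h.2, (hsub h.2).1 h.1⟩⟩

end DyadicInterval

/-- The `L²`-normalized Haar function `h_I = |I|^{-1/2} (χ_{I₊} - χ_{I₋})`. -/
def haar (I : DyadicInterval) (x : ℝ) : ℝ :=
  (√I.len)⁻¹ * (I.right.toSet.indicator 1 x - I.left.toSet.indicator 1 x)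

/-- A weight on the line: a locally integrable function that is positive almost everywhere. -/
def IsWeight (w : ℝ → ℝ) : Prop :=
  LocallyIntegrable w volume ∧ ∀ᵐ x, 0 < w x

/-- The `C^d_s`-characteristic `sup_I (m_I w^s) (m_I w)^{-s}`, with values in `[0, ∞]`. -/
def cChar (s : ℝ) (w : ℝ → ℝ) : ENNReal :=
  ⨆ I : DyadicInterval,
    (⨍⁻ x in I.toSet, ENNReal.ofReal (w x ^ s) ∂volume) *
      (⨍⁻ x in I.toSet, ENNReal.ofReal (w x) ∂volume) ^ (-s)

/-- The class `C^d_s`. -/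
def MemC (s : ℝ) (w : ℝ → ℝ) : Prop :=
  IsWeight w ∧ cChar s w < ⊤

/-- The dyadic Muckenhoupt characteristic
`sup_I (m_I w) (m_I w^{-1/(p-1)})^{p-1}`, with values in `[0, ∞]`. -/
def aChar (p : ℝ) (w : ℝ → ℝ) : ENNReal :=
  ⨆ I : DyadicInterval,
    (⨍⁻ x in I.toSet, ENNReal.ofReal (w x) ∂volume) *
      (⨍⁻ x in I.toSet, ENNReal.ofReal (w x ^ (-1 / (p - 1))) ∂volume) ^ (p - 1)

/-- The dyadic Muckenhoupt class `A^d_p`, for `1 < p < ∞`. -/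
def MemA (p : ℝ) (w : ℝ → ℝ) : Prop :=
  IsWeight w ∧ aChar p w < ⊤

/-- The summand of the `t`-Haar multiplier of complexity `(m, n)` that belongs to `L`:
`∑_{I ∈ 𝒟_m(L), J ∈ 𝒟_n(L)} (√(|I| |J|) / |L|) (w(x) / m_L w)^t ⟨f, h_I⟩ h_J(x)`. -/
def haarBlock (t : ℝ) (w : ℝ → ℝ) (m n : ℕ) (L : DyadicInterval) (f : ℝ → ℂ) (x : ℝ) : ℂ :=
  ∑ I ∈ L.descendants m, ∑ J ∈ L.descendants n,
    ((√(I.len * J.len) / L.len * (w x ^ t / (⨍ y in L.toSet, w y ∂volume) ^ t) : ℝ) : ℂ) *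
      (∫ y, f y * (haar I y : ℂ)) * (haar J x : ℂ)

/-- `T` is the `t`-Haar multiplier of complexity `(m, n)` on `L²(ℝ)`: for every `f`, each summand
is in `L²`, and the series over the dyadic intervals `L` converges unconditionally in `L²` to
`T f`. -/
def IsHaarMultiplier (t : ℝ) (w : ℝ → ℝ) (m n : ℕ)
    (T : Lp ℂ 2 (volume : Measure ℝ) →L[ℂ] Lp ℂ 2 (volume : Measure ℝ)) : Prop :=
  ∀ f : Lp ℂ 2 (volume : Measure ℝ),
    ∃ hmem : ∀ L : DyadicInterval, MemLp (haarBlock t w m n L f) 2 volume,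
      HasSum (fun L : DyadicInterval => (hmem L).toLp (haarBlock t w m n L f)) (T f)

end DyadicHaar

end

/-! Put v = w^{2t}. Tested against g, the block of L pairs the numbers ⟨f, h_I⟩ with the numbers ⟨g,
w^t h_J⟩. The C-condition bounds (m_L w)^{-2t} by [w]_C / m_L v, so each coefficient is at most
[w]_C^{1/2} √(|I|/|L|) √(|J|/(|L| m_L v)) (`abs_coeff_le`). The squares of the middle factors sum to
at most 1 over 𝒟_m(L), and those of the last factors, weighted by m_J v, sum to at most 1 over
𝒟_n(L). Cauchy-Schwarz inside each block, and then over L, where each I and each J belongs to at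
most one block, leaves two Bessel sums: ∑ |⟨f, h_I⟩|² and ∑ |⟨g, v^{1/2} h_J⟩|² / m_J v.
`exists_hasSum_of_bessel` converts this into unconditional convergence and a norm bound, which does
not depend on m and n at all.

The core is the bound C_q [v]_A ‖g‖² for the second sum (`sum_sq_integral_mul_haar_le`), proved with
a Bellman function. With G = m_J(g v^{1/2}) and x = m_J v, each term is |J| (ΔG/2)² / x, where Δ is
the difference between the two halves of J. Convexity of G²/x controls only the part of ΔG/2 that
differs from (G/x) Δx/2. The remaining part is paid for by G²/D, where D is comparable to x and
concave with a gain of order (Δx)²/(Qx). D also involves y = m_J v^{-1/(q-1)}, and its construction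
rests on 1 ≤ x y^{q-1} ≤ Q. Telescoping over scales finishes the estimate
(`sum_le_of_superadditive`). -/

namespace DyadicHaar

/-! ### Convexity inequalities and the Bellman function -/

/-- Midpoint concavity of `x ^ a * y ^ b` for `2 a + b = 1`, with a quadratic gain in `x`. -/
theorem rpow_mul_rpow_midpoint {a b x y x₁ x₂ y₁ y₂ : ℝ} (ha : 0 < a) (hb : 0 ≤ b)
    (hab : 2 * a + b = 1) (hx₁ : 0 < x₁) (hx₂ : 0 < x₂) (hy₁ : 0 < y₁) (hy₂ : 0 < y₂)
    (hx : x = (x₁ + x₂) / 2) (hy : y = (y₁ + y₂) / 2) :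
    (x₁ ^ a * y₁ ^ b + x₂ ^ a * y₂ ^ b) / 2 + a / 16 * (x ^ a * y ^ b) * ((x₁ - x₂) / x) ^ 2
      ≤ x ^ a * y ^ b := by
  have hx0 : 0 < x := by rw [hx]; positivity
  have hy0 : 0 < y := by rw [hy]; positivity
  -- As a function of √x and y the product is homogeneous of degree 2a + b = 1, hence concave. The
  -- quadratic gain is the loss in the concavity of the square root.
  set E := (√x₁ + √x₂) / 2 with hE
  have hs₁ := Real.sqrt_pos.2 hx₁
  have hs₂ := Real.sqrt_pos.2 hx₂
  have hE0 : 0 < E := by positivity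
  have pt : ∀ z r : ℝ, 0 < z → 0 < r →
      z ^ a * r ^ b ≤ E ^ (2 * a) * y ^ b * (2 * a * (√z / E) + b * (r / y)) := by
    intro z r hz hr
    have h := Real.geom_mean_le_arith_mean2_weighted (p₁ := √z / E) (p₂ := r / y)
      (by positivity : 0 ≤ 2 * a) hb (by positivity) (by positivity) hab
    have e : z ^ a = √z ^ (2 * a) := by
      rw [Real.rpow_mul (Real.sqrt_nonneg z), Real.rpow_two, Real.sq_sqrt hz.le]
    calc z ^ a * r ^ b = E ^ (2 * a) * y ^ b * ((√z / E) ^ (2 * a) * (r / y) ^ b) := by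
          rw [Real.div_rpow (by positivity) hE0.le, Real.div_rpow hr.le hy0.le, e]
          have := (Real.rpow_pos_of_pos hE0 (2 * a)).ne'
          have := (Real.rpow_pos_of_pos hy0 b).ne'
          field_simp
      _ ≤ _ := mul_le_mul_of_nonneg_left h (by positivity)
  have havg : (x₁ ^ a * y₁ ^ b + x₂ ^ a * y₂ ^ b) / 2 ≤ E ^ (2 * a) * y ^ b := by
    have h1 := pt x₁ y₁ hx₁ hy₁
    have h2 := pt x₂ y₂ hx₂ hy₂
    have e1 : √x₁ / E + √x₂ / E = 2 := by
      rw [← add_div, div_eq_iff hE0.ne', hE]; ring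
    have e2 : y₁ / y + y₂ / y = 2 := by
      rw [← add_div, div_eq_iff hy0.ne', hy]; ring
    have e3 : (2 * a * (√x₁ / E) + b * (y₁ / y)) + (2 * a * (√x₂ / E) + b * (y₂ / y)) = 2 := by
      linear_combination 2 * a * e1 + b * e2 + 2 * hab
    have e4 := congrArg (fun z => E ^ (2 * a) * y ^ b * z) e3
    simp only [mul_add (E ^ (2 * a) * y ^ b)] at e4 h1 h2
    linarith
  set s := (x₁ - x₂) / x with hs
  have hs2 : s ^ 2 ≤ 4 := by
    have : |s| ≤ 2 := by
      rw [hs, abs_div, abs_of_pos hx0, div_le_iff₀ hx0, abs_le]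
      constructor <;> linarith
    nlinarith [abs_nonneg s, sq_abs s]
  -- Here E² = (x + √(x₁x₂))/2 and √(x₁x₂) = x √(1 - s²/4) ≤ x (1 - s²/8).
  have hE2 : E ^ 2 ≤ x * (1 + -(s ^ 2 / 16)) := by
    have hm : √x₁ * √x₂ ≤ x * (1 - s ^ 2 / 8) := by
      rw [← Real.sqrt_mul hx₁.le]
      apply Real.sqrt_le_iff.2
      refine ⟨mul_nonneg hx0.le (by linarith), ?_⟩
      have hsx : x ^ 2 * s ^ 2 = (x₁ - x₂) ^ 2 := by
        rw [hs]; field_simp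
      have : (x * (1 - s ^ 2 / 8)) ^ 2
          = x ^ 2 - x ^ 2 * s ^ 2 / 4 + (x * s ^ 2 / 8) ^ 2 := by ring
      rw [this, hsx, hx]
      nlinarith [sq_nonneg (((x₁ + x₂) / 2) * s ^ 2 / 8)]
    have : E ^ 2 = (√x₁ ^ 2 + √x₂ ^ 2 + 2 * (√x₁ * √x₂)) / 4 := by rw [hE]; ring
    rw [this, Real.sq_sqrt hx₁.le, Real.sq_sqrt hx₂.le]
    linarith
  have hEa : E ^ (2 * a) ≤ x ^ a * (1 - a * s ^ 2 / 16) := by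
    rw [Real.rpow_mul hE0.le, Real.rpow_two]
    calc (E ^ 2) ^ a ≤ (x * (1 + -(s ^ 2 / 16))) ^ a :=
          Real.rpow_le_rpow (by positivity) hE2 ha.le
      _ = x ^ a * (1 + -(s ^ 2 / 16)) ^ a := Real.mul_rpow hx0.le (by linarith)
      _ ≤ x ^ a * (1 + a * -(s ^ 2 / 16)) := by
          gcongr
          exact rpow_one_add_le_one_add_mul_self (by linarith) ha.le (by linarith)
      _ = _ := by ring
  have hyb : 0 < y ^ b := Real.rpow_pos_of_pos hy0 b
  nlinarith [mul_le_mul_of_nonneg_right hEa hyb.le]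

/-- Midpoint convexity of `y ^ (-p) / β` on the positive quadrant. -/
theorem rpow_neg_div_midpoint {p y β y₁ y₂ β₁ β₂ : ℝ} (hp : 0 ≤ p)
    (hy₁ : 0 < y₁) (hy₂ : 0 < y₂) (hβ₁ : 0 < β₁) (hβ₂ : 0 < β₂)
    (hy : y = (y₁ + y₂) / 2) (hβ : β = (β₁ + β₂) / 2) :
    y ^ (-p) / β ≤ (y₁ ^ (-p) / β₁ + y₂ ^ (-p) / β₂) / 2 := by
  have hy0 : 0 < y := by rw [hy]; positivity
  have hβ0 : 0 < β := by rw [hβ]; positivity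
  -- Tangent plane at (y, β): the function is exp of -p log r - log z, and both exp and -log lie
  -- above their tangents.
  have pt : ∀ r z : ℝ, 0 < r → 0 < z →
      y ^ (-p) / β * (1 - p * (r / y - 1) - (z / β - 1)) ≤ r ^ (-p) / z := by
    intro r z hr hz
    have hr' : 0 < r / y := by positivity
    have hz' : 0 < z / β := by positivity
    have h1 := Real.log_le_sub_one_of_pos hr'
    have h2 := Real.log_le_sub_one_of_pos hz'
    have h3 := Real.add_one_le_exp (Real.log (r / y) * -p - Real.log (z / β))
    rw [Real.exp_sub, ← Real.rpow_def_of_pos hr', Real.exp_log hz',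
      Real.div_rpow hr.le hy0.le] at h3
    have h4 := mul_le_mul_of_nonneg_left h1 hp
    have hyp : 0 < y ^ (-p) := Real.rpow_pos_of_pos hy0 _
    calc y ^ (-p) / β * (1 - p * (r / y - 1) - (z / β - 1))
        ≤ y ^ (-p) / β * (r ^ (-p) / y ^ (-p) / (z / β)) := by
          apply mul_le_mul_of_nonneg_left _ (by positivity)
          linarith
      _ = r ^ (-p) / z := by field_simp
  have h1 := pt y₁ β₁ hy₁ hβ₁
  have h2 := pt y₂ β₂ hy₂ hβ₂
  have e1 : y₁ / y + y₂ / y = 2 := by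
    rw [← add_div, div_eq_iff hy0.ne', hy]; ring
  have e2 : β₁ / β + β₂ / β = 2 := by
    rw [← add_div, div_eq_iff hβ0.ne', hβ]; ring
  have e3 : (1 - p * (y₁ / y - 1) - (β₁ / β - 1)) + (1 - p * (y₂ / y - 1) - (β₂ / β - 1)) = 2 := by
    linear_combination -p * e1 - e2
  have : y ^ (-p) / β * ((1 - p * (y₁ / y - 1) - (β₁ / β - 1))
      + (1 - p * (y₂ / y - 1) - (β₂ / β - 1))) = y ^ (-p) / β * 2 := by rw [e3]
  linarith

/-- The quotient `(x y^{q-1} / Q)^{1/(q+1)}`. -/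
noncomputable def bellmanAux (q Q x y : ℝ) : ℝ :=
  x ^ (1 / (q + 1)) * y ^ ((q - 1) / (q + 1)) / Q ^ (1 / (q + 1))

/-- The concave majorant of `x` used as denominator in the Bellman function. -/
noncomputable def bellmanDenom (q Q x y : ℝ) : ℝ :=
  2 * x - y ^ (-(q - 1)) / (1 + bellmanAux q Q x y)

theorem bellmanAux_pos {q Q x y : ℝ} (hQ : 0 < Q) (hx : 0 < x) (hy : 0 < y) :
    0 < bellmanAux q Q x y := by
  unfold bellmanAux; positivity

theorem bellmanAux_eq {q Q x y : ℝ} (hQ : 0 < Q) (hx : 0 < x) (hy : 0 < y) :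
    bellmanAux q Q x y = (x * y ^ (q - 1) / Q) ^ (1 / (q + 1)) := by
  unfold bellmanAux
  rw [Real.div_rpow (by positivity) hQ.le, Real.mul_rpow hx.le (by positivity),
    ← Real.rpow_mul hy.le, mul_one_div]

theorem bellmanDenom_le {q Q x y : ℝ} (hQ : 0 < Q) (hx : 0 < x) (hy : 0 < y) :
    bellmanDenom q Q x y ≤ 2 * x := by
  have := bellmanAux_pos (q := q) hQ hx hy
  have : 0 < y ^ (-(q - 1)) / (1 + bellmanAux q Q x y) := by positivity
  unfold bellmanDenom; linarith

/-- Hölder's bound makes the subtracted term at most x. Together with `bellmanDenom_le`, this makes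
the denominator comparable to x uniformly in Q. -/
theorem le_bellmanDenom {q Q x y : ℝ} (hQ : 0 < Q) (hx : 0 < x) (hy : 0 < y)
    (hxy : 1 ≤ x * y ^ (q - 1)) : x ≤ bellmanDenom q Q x y := by
  have h := bellmanAux_pos (q := q) hQ hx hy
  have hyp : 0 < y ^ (q - 1) := by positivity
  have h1 : y ^ (-(q - 1)) ≤ x := by
    rw [Real.rpow_neg hy.le, inv_le_iff_one_le_mul₀ hyp]; exact hxy
  have : y ^ (-(q - 1)) / (1 + bellmanAux q Q x y) ≤ x :=
    (div_le_self (by positivity) (by linarith)).trans h1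
  unfold bellmanDenom; linarith

/-- The quotient y^{-(q-1)}/β is jointly convex and decreasing in β, so the concavity gain of β = 1
+ α passes to the denominator. The upper bound by Q is needed only at the midpoint. -/
theorem bellmanDenom_midpoint {q Q x y x₁ x₂ y₁ y₂ : ℝ} (hq : 1 < q) (hQ : 0 < Q)
    (hx₁ : 0 < x₁) (hx₂ : 0 < x₂) (hy₁ : 0 < y₁) (hy₂ : 0 < y₂)
    (hx : x = (x₁ + x₂) / 2) (hy : y = (y₁ + y₂) / 2)
    (hxy : x * y ^ (q - 1) ≤ Q) :
    (bellmanDenom q Q x₁ y₁ + bellmanDenom q Q x₂ y₂) / 2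
      + 1 / (64 * (q + 1) * Q) * ((x₁ - x₂) ^ 2 / x) ≤ bellmanDenom q Q x y := by
  have hx0 : 0 < x := by rw [hx]; positivity
  have hy0 : 0 < y := by rw [hy]; positivity
  set a := 1 / (q + 1) with ha
  have ha0 : 0 < a := by positivity
  have ha1 : a ≤ 1 := by rw [ha, div_le_one] <;> linarith
  set α := bellmanAux q Q x y with hα
  set α₁ := bellmanAux q Q x₁ y₁ with hα₁
  set α₂ := bellmanAux q Q x₂ y₂ with hα₂
  have p0 : 0 < α := bellmanAux_pos hQ hx0 hy0
  have p1 : 0 < α₁ := bellmanAux_pos hQ hx₁ hy₁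
  have p2 : 0 < α₂ := bellmanAux_pos hQ hx₂ hy₂
  set s := (x₁ - x₂) / x with hs
  have hgain : (α₁ + α₂) / 2 + a / 16 * α * s ^ 2 ≤ α := by
    have h := rpow_mul_rpow_midpoint (a := a) (b := (q - 1) / (q + 1)) ha0
      (div_nonneg (by linarith) (by linarith)) (by rw [ha]; field_simp; ring)
      hx₁ hx₂ hy₁ hy₂ hx hy
    have hQa : 0 < Q ^ a := by positivity
    have h' := div_le_div_of_nonneg_right h hQa.le
    refine le_trans (le_of_eq ?_) h'
    rw [hα, hα₁, hα₂]
    unfold bellmanAux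
    rw [← ha]
    ring
  have hα_le : α ≤ 1 := by
    rw [hα, bellmanAux_eq hQ hx0 hy0]
    exact Real.rpow_le_one (by positivity) ((div_le_one hQ).2 hxy) ha0.le
  -- A number in [0, 1] does not decrease under a power in (0, 1]. This keeps the final gain linear
  -- in 1/Q.
  have hα_ge : x * y ^ (q - 1) / Q ≤ α := by
    rw [hα, bellmanAux_eq hQ hx0 hy0]
    exact Real.self_le_rpow_of_le_one (by positivity) ((div_le_one hQ).2 hxy) ha1
  set αb := (α₁ + α₂) / 2 with hαb
  have hαb0 : 0 < αb := by positivity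
  have hg0 : 0 ≤ a / 16 * α * s ^ 2 := by positivity
  have hconv := rpow_neg_div_midpoint (p := q - 1) (y := y) (β := 1 + αb) (β₁ := 1 + α₁)
    (β₂ := 1 + α₂) (by linarith) hy₁ hy₂ (by linarith) (by linarith) hy (by rw [hαb]; ring)
  set Y := y ^ (-(q - 1)) with hY
  have hY0 : 0 < Y := by positivity
  have hYy : Y * y ^ (q - 1) = 1 := by
    rw [hY, ← Real.rpow_add hy0]; simp
  have hdrop : Y / (1 + α) + Y * (a / 16 * α * s ^ 2) / 4 ≤ Y / (1 + αb) := by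
    have : Y / (1 + αb) - Y / (1 + α) = Y * (α - αb) / ((1 + αb) * (1 + α)) := by
      field_simp; ring
    have h4 : (1 + αb) * (1 + α) ≤ 4 := by nlinarith
    have h5 : Y * (a / 16 * α * s ^ 2) / 4 ≤ Y * (α - αb) / ((1 + αb) * (1 + α)) := by
      apply div_le_div₀ _ _ (by positivity) h4
      · apply mul_nonneg hY0.le; linarith
      · apply mul_le_mul_of_nonneg_left _ hY0.le; linarith
    linarith
  have hfin : 1 / (64 * (q + 1) * Q) * ((x₁ - x₂) ^ 2 / x) ≤ Y * (a / 16 * α * s ^ 2) / 4 := by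
    calc 1 / (64 * (q + 1) * Q) * ((x₁ - x₂) ^ 2 / x)
        = a / 64 * s ^ 2 * (Y * (x * y ^ (q - 1) / Q)) := by
          have : Y * (x * y ^ (q - 1) / Q) = x / Q := by
            rw [show Y * (x * y ^ (q - 1) / Q) = (Y * y ^ (q - 1)) * (x / Q) by ring, hYy, one_mul]
          rw [this, ha, hs]; field_simp
      _ ≤ a / 64 * s ^ 2 * (Y * α) := by gcongr
      _ = _ := by ring
  unfold bellmanDenom
  rw [← hα, ← hα₁, ← hα₂]
  linarith

/-- Convexity of `g² / x`, with the defect. -/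
theorem sq_div_midpoint {g g₁ g₂ x x₁ x₂ : ℝ} (hx₁ : 0 < x₁) (hx₂ : 0 < x₂)
    (hg : g = (g₁ + g₂) / 2) (hx : x = (x₁ + x₂) / 2) :
    g ^ 2 / x + ((g₁ - g₂) / 2 - g / x * ((x₁ - x₂) / 2)) ^ 2 / x
      ≤ (g₁ ^ 2 / x₁ + g₂ ^ 2 / x₂) / 2 := by
  have hx0 : 0 < x := by rw [hx]; positivity
  -- Subtracting the line ρx leaves ±η at the two ends; the linear parts average out, and convexity
  -- of 1/x handles η²/x.
  set ρ := g / x with hρ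
  set η := (g₁ - g₂) / 2 - ρ * ((x₁ - x₂) / 2) with hη
  have hgx : g = ρ * x := by rw [hρ]; field_simp
  have e1 : g₁ = ρ * x₁ + η := by
    have : g₁ = g + (g₁ - g₂) / 2 := by rw [hg]; ring
    rw [this, hgx, hη, hx]; ring
  have e2 : g₂ = ρ * x₂ - η := by
    have : g₂ = g - (g₁ - g₂) / 2 := by rw [hg]; ring
    rw [this, hgx, hη, hx]; ring
  have h1 : g₁ ^ 2 / x₁ = ρ ^ 2 * x₁ + 2 * ρ * η + η ^ 2 / x₁ := by
    rw [e1]; field_simp; ring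
  have h2 : g₂ ^ 2 / x₂ = ρ ^ 2 * x₂ - 2 * ρ * η + η ^ 2 / x₂ := by
    rw [e2]; field_simp; ring
  have h3 : g ^ 2 / x = ρ ^ 2 * x := by rw [hgx]; field_simp
  have h4 : 1 / x ≤ (1 / x₁ + 1 / x₂) / 2 := by
    rw [hx, div_add_div _ _ hx₁.ne' hx₂.ne', div_div, div_le_div_iff₀ (by positivity) (by positivity)]
    nlinarith [sq_nonneg (x₁ - x₂)]
  have h5 := mul_le_mul_of_nonneg_left h4 (sq_nonneg η)
  rw [h1, h2, h3]
  have h6 : ρ ^ 2 * x = (ρ ^ 2 * x₁ + ρ ^ 2 * x₂) / 2 := by rw [hx]; ring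
  rw [h6]
  have e7 : η ^ 2 * (1 / x) = η ^ 2 / x := by ring
  have e8 : η ^ 2 * ((1 / x₁ + 1 / x₂) / 2) = (η ^ 2 / x₁ + η ^ 2 / x₂) / 2 := by ring
  linarith

/-- The Bellman inequality for the square function with weight. -/
theorem bellman_midpoint {q Q g g₁ g₂ x y x₁ x₂ y₁ y₂ : ℝ} (hq : 1 < q) (hQ : 0 < Q)
    (hx₁ : 0 < x₁) (hx₂ : 0 < x₂) (hy₁ : 0 < y₁) (hy₂ : 0 < y₂)
    (hg : g = (g₁ + g₂) / 2) (hx : x = (x₁ + x₂) / 2) (hy : y = (y₁ + y₂) / 2)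
    (hxy : x * y ^ (q - 1) ≤ Q) (h1 : 1 ≤ x * y ^ (q - 1))
    (hxy₁ : 1 ≤ x₁ * y₁ ^ (q - 1)) (hxy₂ : 1 ≤ x₂ * y₂ ^ (q - 1)) :
    ((g₁ - g₂) / 2) ^ 2 / x ≤
      2 * ((g₁ ^ 2 / x₁ + g₂ ^ 2 / x₂) / 2 - g ^ 2 / x) +
      128 * (q + 1) * Q * ((g₁ ^ 2 / bellmanDenom q Q x₁ y₁ + g₂ ^ 2 / bellmanDenom q Q x₂ y₂) / 2
        - g ^ 2 / bellmanDenom q Q x y) := by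
  have hx0 : 0 < x := by rw [hx]; positivity
  have hy0 : 0 < y := by rw [hy]; positivity
  have hA := sq_div_midpoint hx₁ hx₂ hg hx
  have hD := le_bellmanDenom (Q := Q) hQ hx0 hy0 h1
  have hD' := bellmanDenom_le (q := q) hQ hx0 hy0
  have hD₁ := le_bellmanDenom (Q := Q) hQ hx₁ hy₁ hxy₁
  have hD₂ := le_bellmanDenom (Q := Q) hQ hx₂ hy₂ hxy₂
  have hmid := bellmanDenom_midpoint hq hQ hx₁ hx₂ hy₁ hy₂ hx hy hxy
  set D := bellmanDenom q Q x y
  set D₁ := bellmanDenom q Q x₁ y₁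
  set D₂ := bellmanDenom q Q x₂ y₂
  have hB := sq_div_midpoint (x := (D₁ + D₂) / 2) (hx₁.trans_le hD₁) (hx₂.trans_le hD₂) hg rfl
  have hDb : 0 < (D₁ + D₂) / 2 := by linarith
  set Db := (D₁ + D₂) / 2
  set κ := 1 / (64 * (q + 1) * Q) with hκ
  have hκ0 : 0 < κ := by positivity
  set δ := (x₁ - x₂) ^ 2 / x with hδ
  have hδ0 : 0 ≤ δ := by positivity
  have hD0 : 0 < D := hx0.trans_le hD
  -- The mean Db lies below D by at least κδ, and both are at most 2x, which gives 4x².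
  have hC : g ^ 2 / D + κ * (g ^ 2 * δ / (4 * x ^ 2)) ≤ g ^ 2 / Db := by
    have e : g ^ 2 / Db - g ^ 2 / D = g ^ 2 * (D - Db) / (Db * D) := by field_simp
    have hle : g ^ 2 * (κ * δ) / (4 * x ^ 2) ≤ g ^ 2 * (D - Db) / (Db * D) := by
      apply div_le_div₀ _ _ (by positivity) _
      · apply mul_nonneg (sq_nonneg g); linarith [mul_nonneg hκ0.le hδ0]
      · apply mul_le_mul_of_nonneg_left _ (sq_nonneg g); linarith
      · calc Db * D ≤ (2 * x) * (2 * x) := by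
              have : 0 ≤ κ * δ := by positivity
              gcongr
              linarith
          _ = 4 * x ^ 2 := by ring
    have : κ * (g ^ 2 * δ / (4 * x ^ 2)) = g ^ 2 * (κ * δ) / (4 * x ^ 2) := by ring
    linarith
  have hB' : 0 ≤ ((g₁ - g₂) / 2 - g / Db * ((D₁ - D₂) / 2)) ^ 2 / Db := by positivity
  have hgain : κ * (g ^ 2 * δ / (4 * x ^ 2)) ≤ (g₁ ^ 2 / D₁ + g₂ ^ 2 / D₂) / 2 - g ^ 2 / D := by
    linarith
  have hgain' : g ^ 2 * δ / (2 * x ^ 2)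
      ≤ 128 * (q + 1) * Q * ((g₁ ^ 2 / D₁ + g₂ ^ 2 / D₂) / 2 - g ^ 2 / D) := by
    have h := mul_le_mul_of_nonneg_left hgain (by positivity : 0 ≤ 128 * (q + 1) * Q)
    have e : 128 * (q + 1) * Q * (κ * (g ^ 2 * δ / (4 * x ^ 2))) = g ^ 2 * δ / (2 * x ^ 2) := by
      rw [hκ]; field_simp; ring
    linarith
  set γ := (g₁ - g₂) / 2
  set σ := g / x * ((x₁ - x₂) / 2) with hσ
  -- The part γ - σ is the convexity defect of g²/x; σ is paid for by the gain in D. The constant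
  -- 128 makes its product with κ equal to 2.
  have hsplit : γ ^ 2 / x ≤ 2 * ((γ - σ) ^ 2 / x) + 2 * (σ ^ 2 / x) := by
    rw [← mul_div_assoc, ← mul_div_assoc, ← add_div]
    apply div_le_div_of_nonneg_right _ hx0.le
    nlinarith [sq_nonneg (γ - 2 * σ)]
  have hσ' : 2 * (σ ^ 2 / x) = g ^ 2 * δ / (2 * x ^ 2) := by
    rw [hσ, hδ]; field_simp
  refine hsplit.trans (add_le_add (by linarith) ?_)
  rw [hσ']
  exact hgain'

/-! ### Operators from two Bessel families -/

open scoped InnerProductSpace in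
/-- Two Bessel families with matching block coefficients define a bounded operator by an
unconditionally convergent series of finite rank operators. -/
theorem exists_hasSum_of_bessel {ι E : Type*} [NormedAddCommGroup E] [InnerProductSpace ℂ E]
    [CompleteSpace E] {φ ψ : ι → E} {x : ι → ℝ} (hx : ∀ i, 0 < x i) {dm dn : ι → Finset ι}
    (hdm : Pairwise fun L L' => Disjoint (dm L) (dm L'))
    (hdn : Pairwise fun L L' => Disjoint (dn L) (dn L'))
    {c : ι → ι → ι → ℝ} {κ : ℝ} {α β : ι → ι → ℝ} (hκ : 0 ≤ κ)
    (hc : ∀ L, ∀ I ∈ dm L, ∀ J ∈ dn L, |c L I J| ≤ κ * (α L I * β L J))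
    (hα : ∀ L, ∑ I ∈ dm L, α L I ^ 2 ≤ 1) (hβ : ∀ L, ∑ J ∈ dn L, β L J ^ 2 * x J ≤ 1)
    {K₁ K₂ : ℝ} (hK₁ : 0 ≤ K₁) (hK₂ : 0 ≤ K₂)
    (hφ : ∀ (f : E) (F : Finset ι), ∑ I ∈ F, ‖⟪φ I, f⟫_ℂ‖ ^ 2 ≤ K₁ * ‖f‖ ^ 2)
    (hψ : ∀ (f : E) (F : Finset ι), ∑ J ∈ F, ‖⟪ψ J, f⟫_ℂ‖ ^ 2 / x J ≤ K₂ * ‖f‖ ^ 2) :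
    ∃ T : E →L[ℂ] E,
      (∀ f, HasSum (fun L => ∑ I ∈ dm L, ∑ J ∈ dn L, ((c L I J : ℂ) * ⟪φ I, f⟫_ℂ) • ψ J) (T f)) ∧
      ‖T‖ ≤ κ * √K₁ * √K₂ := by
  classical
  set blk : ι → E → E := fun L f =>
    ∑ I ∈ dm L, ∑ J ∈ dn L, ((c L I J : ℂ) * ⟪φ I, f⟫_ℂ) • ψ J with hblk
  set a : ι → E → ℝ := fun L f => ∑ I ∈ dm L, ‖⟪φ I, f⟫_ℂ‖ ^ 2 with ha
  set b : ι → E → ℝ := fun L f => ∑ J ∈ dn L, ‖⟪ψ J, f⟫_ℂ‖ ^ 2 / x J with hb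
  have ha0 : ∀ L f, 0 ≤ a L f := fun L f => Finset.sum_nonneg fun _ _ => by positivity
  have hb0 : ∀ L f, 0 ≤ b L f := fun L f => Finset.sum_nonneg fun J _ => by
    have := hx J
    positivity
  have hasum : ∀ f (F : Finset ι), ∑ L ∈ F, a L f ≤ K₁ * ‖f‖ ^ 2 := by
    intro f F
    rw [ha, ← Finset.sum_biUnion fun L _ L' _ h => hdm h]
    exact hφ f _
  have hbsum : ∀ f (F : Finset ι), ∑ L ∈ F, b L f ≤ K₂ * ‖f‖ ^ 2 := by
    intro f F
    rw [hb, ← Finset.sum_biUnion fun L _ L' _ h => hdn h]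
    exact hψ f _
  have hone : ∀ L f g, ‖⟪g, blk L f⟫_ℂ‖ ≤ κ * (√(a L f) * √(b L g)) := by
    intro L f g
    have h1 : ‖⟪g, blk L f⟫_ℂ‖
        ≤ κ * ((∑ I ∈ dm L, |α L I| * ‖⟪φ I, f⟫_ℂ‖) *
          (∑ J ∈ dn L, (|β L J| * √(x J)) * (‖⟪ψ J, g⟫_ℂ‖ / √(x J)))) := by
      rw [hblk, inner_sum, Finset.sum_mul_sum, Finset.mul_sum]
      refine (norm_sum_le _ _).trans (Finset.sum_le_sum fun I hI => ?_)
      rw [inner_sum, Finset.mul_sum]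
      refine (norm_sum_le _ _).trans (Finset.sum_le_sum fun J hJ => ?_)
      rw [inner_smul_right, norm_mul, norm_mul, Complex.norm_real, Real.norm_eq_abs,
        norm_inner_symm g]
      have hxJ := Real.sqrt_pos.2 (hx J)
      have h2 : |c L I J| ≤ κ * (|α L I| * |β L J|) := by
        refine (hc L I hI J hJ).trans ?_
        rw [← abs_mul]
        gcongr
        exact le_abs_self _
      calc |c L I J| * ‖⟪φ I, f⟫_ℂ‖ * ‖⟪ψ J, g⟫_ℂ‖
          ≤ κ * (|α L I| * |β L J|) * ‖⟪φ I, f⟫_ℂ‖ * ‖⟪ψ J, g⟫_ℂ‖ := by gcongr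
        _ = _ := by field_simp
    refine h1.trans (mul_le_mul_of_nonneg_left ?_ hκ)
    apply mul_le_mul
    · refine (Real.sum_mul_le_sqrt_mul_sqrt _ _ _).trans ?_
      refine mul_le_of_le_one_left (Real.sqrt_nonneg _) ?_
      simpa using hα L
    · refine (Real.sum_mul_le_sqrt_mul_sqrt _ _ _).trans ?_
      have e1 : ∑ J ∈ dn L, (|β L J| * √(x J)) ^ 2 ≤ 1 := by
        refine le_trans (le_of_eq (Finset.sum_congr rfl fun J _ => ?_)) (hβ L)
        rw [mul_pow, sq_abs, Real.sq_sqrt (hx J).le]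
      have e2 : ∑ J ∈ dn L, (‖⟪ψ J, g⟫_ℂ‖ / √(x J)) ^ 2 = b L g := by
        refine Finset.sum_congr rfl fun J _ => ?_
        rw [div_pow, Real.sq_sqrt (hx J).le]
      rw [e2]
      exact mul_le_of_le_one_left (Real.sqrt_nonneg _) (Real.sqrt_le_one.2 e1)
    · exact Finset.sum_nonneg fun J _ => by positivity
    · exact Real.sqrt_nonneg _
  -- The partial sum is its own test vector. Keeping the sum of `a L f` unestimated lets the same
  -- bound serve as Cauchy criterion and as norm bound.
  have hnorm : ∀ f (F : Finset ι), ‖∑ L ∈ F, blk L f‖ ≤ κ * √K₂ * √(∑ L ∈ F, a L f) := by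
    intro f F
    set g := ∑ L ∈ F, blk L f with hg
    have h1 : ‖g‖ * ‖g‖ ≤ κ * √K₂ * √(∑ L ∈ F, a L f) * ‖g‖ := by
      calc ‖g‖ * ‖g‖ = ‖⟪g, g⟫_ℂ‖ := by
            rw [inner_self_eq_norm_sq_to_K]; simp [sq]
        _ = ‖∑ L ∈ F, ⟪g, blk L f⟫_ℂ‖ := by rw [← inner_sum]
        _ ≤ ∑ L ∈ F, κ * (√(a L f) * √(b L g)) :=
            (norm_sum_le _ _).trans (Finset.sum_le_sum fun L _ => hone L f g)
        _ = κ * ∑ L ∈ F, √(a L f) * √(b L g) := by rw [Finset.mul_sum]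
        _ ≤ κ * (√(∑ L ∈ F, a L f) * √(∑ L ∈ F, b L g)) := by
            gcongr
            exact Real.sum_sqrt_mul_sqrt_le _ (fun L => ha0 L f) (fun L => hb0 L g)
        _ ≤ κ * (√(∑ L ∈ F, a L f) * (√K₂ * ‖g‖)) := by
            gcongr
            refine (Real.sqrt_le_sqrt (hbsum g F)).trans (le_of_eq ?_)
            rw [Real.sqrt_mul hK₂, Real.sqrt_sq (norm_nonneg g)]
        _ = _ := by ring
    rcases (norm_nonneg g).eq_or_lt with h0 | h0
    · rw [← h0]; positivity
    · exact le_of_mul_le_mul_right h1 h0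
  have hasummable : ∀ f, Summable fun L => a L f := fun f =>
    summable_of_sum_le (fun L => ha0 L f) (hasum f)
  have hsummable : ∀ f, Summable fun L => blk L f := by
    intro f
    rw [summable_iff_vanishing_norm]
    intro ε hε
    -- The 1 keeps M positive when κ√K₂ vanishes.
    set M := κ * √K₂ + 1 with hM
    have hM0 : 0 < M := by positivity
    obtain ⟨s, hs⟩ := summable_iff_vanishing_norm.1 (hasummable f) ((ε / M) ^ 2) (by positivity)
    refine ⟨s, fun t ht => ?_⟩
    have h1 := hs t ht
    rw [Real.norm_of_nonneg (Finset.sum_nonneg fun L _ => ha0 L f)] at h1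
    have h2 : √(∑ L ∈ t, a L f) < ε / M := (Real.sqrt_lt' (by positivity)).2 h1
    calc ‖∑ L ∈ t, blk L f‖ ≤ κ * √K₂ * √(∑ L ∈ t, a L f) := hnorm f t
      _ ≤ M * √(∑ L ∈ t, a L f) := by
          gcongr; linarith
      _ < M * (ε / M) := by gcongr
      _ = ε := by field_simp
  have hbound : ∀ f, ‖∑' L, blk L f‖ ≤ κ * √K₁ * √K₂ * ‖f‖ := by
    intro f
    refine le_of_tendsto ((hsummable f).hasSum.norm) (Filter.Eventually.of_forall fun F => ?_)
    calc ‖∑ L ∈ F, blk L f‖ ≤ κ * √K₂ * √(∑ L ∈ F, a L f) := hnorm f F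
      _ ≤ κ * √K₂ * √(K₁ * ‖f‖ ^ 2) := by gcongr; exact hasum f F
      _ = _ := by rw [Real.sqrt_mul hK₁, Real.sqrt_sq (norm_nonneg f)]; ring
  let T₀ : E →ₗ[ℂ] E :=
    { toFun := fun f => ∑' L, blk L f
      map_add' := by
        intro f g
        rw [← (hsummable f).tsum_add (hsummable g)]
        refine tsum_congr fun L => ?_
        simp only [hblk, inner_add_right, mul_add, add_smul, Finset.sum_add_distrib]
      map_smul' := by
        intro r f
        rw [RingHom.id_apply, ← (hsummable f).tsum_const_smul r]
        refine tsum_congr fun L => ?_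
        simp only [hblk, inner_smul_right, Finset.smul_sum, smul_smul]
        refine Finset.sum_congr rfl fun I _ => Finset.sum_congr rfl fun J _ => ?_
        congr 1; ring }
  refine ⟨T₀.mkContinuous _ hbound, fun f => (hsummable f).hasSum, ?_⟩
  exact LinearMap.mkContinuous_norm_le _ (by positivity) _

/-! ### Geometry of dyadic intervals and averages -/

namespace DyadicInterval

theorem len_left (J : DyadicInterval) : J.left.len = J.len / 2 := by
  unfold left len
  rw [neg_add, zpow_add₀ two_ne_zero]
  norm_num [div_eq_mul_inv]

theorem len_right (J : DyadicInterval) : J.right.len = J.len / 2 := J.len_left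

theorem measurableSet_toSet (J : DyadicInterval) : MeasurableSet J.toSet := measurableSet_Ico

theorem volume_toSet (J : DyadicInterval) : volume J.toSet = ENNReal.ofReal J.len := by
  unfold toSet
  rw [Real.volume_Ico]
  congr 1; ring

theorem volume_real_toSet (J : DyadicInterval) : volume.real J.toSet = J.len := by
  rw [measureReal_def, volume_toSet, ENNReal.toReal_ofReal J.len_pos.le]

theorem toSet_left (J : DyadicInterval) :
    J.left.toSet = Set.Ico (J.pos * J.len) ((J.pos + 1 / 2) * J.len) := by
  unfold toSet
  rw [len_left]
  simp only [left]
  push_cast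
  congr 1 <;> ring

theorem toSet_right (J : DyadicInterval) :
    J.right.toSet = Set.Ico ((J.pos + 1 / 2) * J.len) ((J.pos + 1) * J.len) := by
  unfold toSet
  rw [len_right]
  simp only [right]
  push_cast
  congr 1 <;> ring

theorem left_union_right (J : DyadicInterval) : J.left.toSet ∪ J.right.toSet = J.toSet := by
  have := J.len_pos
  rw [toSet_left, toSet_right, toSet, Set.Ico_union_Ico_eq_Ico] <;> nlinarith

theorem disjoint_left_right (J : DyadicInterval) : Disjoint J.left.toSet J.right.toSet := by
  rw [toSet_left, toSet_right]
  exact Set.Ico_disjoint_Ico_same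

theorem disjoint_toSet {I J : DyadicInterval} (hs : I.scale = J.scale) (h : I ≠ J) :
    Disjoint I.toSet J.toSet := by
  have hl : I.len = J.len := by unfold len; rw [hs]
  have hp : I.pos ≠ J.pos := fun hp => h (DyadicInterval.ext hs hp)
  have hJ := J.len_pos
  unfold toSet
  rw [hl, Set.disjoint_left]
  rintro z ⟨h1, h2⟩ ⟨h3, h4⟩
  have a1 : (I.pos : ℝ) < J.pos + 1 := lt_of_mul_lt_mul_right (h1.trans_lt h4) hJ.le
  have a2 : (J.pos : ℝ) < I.pos + 1 := lt_of_mul_lt_mul_right (h3.trans_lt h2) hJ.le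
  norm_cast at a1 a2
  omega

theorem scale_of_mem_descendants {m : ℕ} {L I : DyadicInterval} (h : I ∈ L.descendants m) :
    I.scale = L.scale + m := by
  unfold descendants at h
  obtain ⟨k, -, rfl⟩ := Finset.mem_map.1 h
  rfl

/-- The left endpoint of a common descendant would lie in two distinct, hence disjoint, intervals of
equal length. -/
theorem pairwise_disjoint_descendants (m : ℕ) :
    Pairwise fun L L' : DyadicInterval => Disjoint (L.descendants m) (L'.descendants m) := by
  intro L L' h
  rw [Finset.disjoint_left]
  intro I hI hI'
  have hs : L.scale = L'.scale := by
    have := scale_of_mem_descendants hI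
    have := scale_of_mem_descendants hI'
    omega
  have hI0 : (I.pos * I.len) ∈ I.toSet := by
    have := I.len_pos
    exact ⟨le_rfl, by nlinarith⟩
  exact Set.disjoint_left.1 (disjoint_toSet hs h) ((mem_descendants.1 hI).1 hI0)
    ((mem_descendants.1 hI').1 hI0)

/-- The integrals of a nonnegative function over disjoint dyadic pieces of `s` are dominated by
the integral over `s`. -/
theorem sum_setIntegral_le {F : Finset DyadicInterval} {k : ℤ} (hk : ∀ I ∈ F, I.scale = k)
    {s : Set ℝ} (hF : ∀ I ∈ F, I.toSet ⊆ s) {f : ℝ → ℝ}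
    (hf : IntegrableOn f s) (hf0 : ∀ᵐ x, 0 ≤ f x) :
    ∑ I ∈ F, ∫ x in I.toSet, f x ≤ ∫ x in s, f x := by
  rw [← integral_biUnion_finset F (fun I _ => I.measurableSet_toSet)
    (fun I hI J hJ h => disjoint_toSet ((hk I hI).trans (hk J hJ).symm) h)
    (fun I hI => hf.mono_set (hF I hI))]
  exact setIntegral_mono_set hf (ae_restrict_of_ae hf0)
    (Set.iUnion₂_subset hF).eventuallyLE

/-- The average of `f` over the interval. -/
noncomputable def avg (J : DyadicInterval) (f : ℝ → ℝ) : ℝ := (∫ x in J.toSet, f x) / J.len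

theorem setIntegral_eq_add (J : DyadicInterval) {E : Type*} [NormedAddCommGroup E]
    [NormedSpace ℝ E] {f : ℝ → E} (hf : IntegrableOn f J.toSet) :
    ∫ x in J.toSet, f x = (∫ x in J.left.toSet, f x) + ∫ x in J.right.toSet, f x := by
  rw [← J.left_union_right] at hf ⊢
  exact setIntegral_union J.disjoint_left_right J.right.measurableSet_toSet
    (hf.mono_set Set.subset_union_left) (hf.mono_set Set.subset_union_right)

theorem avg_eq (J : DyadicInterval) {f : ℝ → ℝ} (hf : IntegrableOn f J.toSet) :
    J.avg f = (J.right.avg f + J.left.avg f) / 2 := by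
  have := J.len_pos
  unfold avg
  rw [J.setIntegral_eq_add hf, len_left, len_right]
  field_simp
  ring

theorem len_mul_avg (J : DyadicInterval) (f : ℝ → ℝ) : J.len * J.avg f = ∫ x in J.toSet, f x := by
  have := J.len_pos
  unfold avg
  field_simp

theorem avg_pos (J : DyadicInterval) {f : ℝ → ℝ} (hf : IntegrableOn f J.toSet)
    (h0 : ∀ᵐ x, 0 < f x) : 0 < J.avg f := by
  apply div_pos _ J.len_pos
  rw [integral_pos_iff_support_of_nonneg_ae (ae_restrict_of_ae (h0.mono fun x hx => hx.le)) hf]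
  have : Function.support f =ᵐ[volume.restrict J.toSet] Set.univ := by
    filter_upwards [ae_restrict_of_ae h0] with x hx
    exact propext ⟨fun _ => trivial, fun _ => ne_of_gt hx⟩
  rw [measure_congr this, Measure.restrict_apply_univ, volume_toSet]
  exact ENNReal.ofReal_pos.2 J.len_pos

theorem integral_mul_haar (J : DyadicInterval) {f : ℝ → ℝ} (hf : IntegrableOn f J.toSet) :
    ∫ x, f x * haar J x = √J.len * ((J.right.avg f - J.left.avg f) / 2) := by
  have hl := J.len_pos
  have hL : IntegrableOn f J.left.toSet :=
    hf.mono_set (J.left_union_right ▸ Set.subset_union_left)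
  have hR : IntegrableOn f J.right.toSet :=
    hf.mono_set (J.left_union_right ▸ Set.subset_union_right)
  have e : ∀ x, f x * haar J x
      = (√J.len)⁻¹ * (J.right.toSet.indicator f x - J.left.toSet.indicator f x) := by
    intro x
    unfold haar
    by_cases h1 : x ∈ J.right.toSet <;> by_cases h2 : x ∈ J.left.toSet <;> simp [h1, h2] <;> ring
  simp_rw [e]
  rw [integral_const_mul, integral_sub (hR.integrable_indicator J.right.measurableSet_toSet)
    (hL.integrable_indicator J.left.measurableSet_toSet),
    integral_indicator J.right.measurableSet_toSet, integral_indicator J.left.measurableSet_toSet,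
    ← len_mul_avg, ← len_mul_avg, len_left, len_right]
  have h : √J.len * √J.len = J.len := Real.mul_self_sqrt hl.le
  have h0 := Real.sqrt_pos.2 hl
  rw [inv_mul_eq_div, div_eq_iff h0.ne']
  linear_combination (-(J.right.avg f - J.left.avg f) / 2) * h

/-- Hölder's inequality in the form `1 ≤ (m_J v) (m_J u)^{q-1}`. -/
theorem one_le_avg_mul_avg_rpow (J : DyadicInterval) {q : ℝ} (hq : 1 < q) {v u : ℝ → ℝ}
    (hv : IntegrableOn v J.toSet) (hu : IntegrableOn u J.toSet) (hv0 : ∀ᵐ x, 0 < v x)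
    (huv : ∀ᵐ x, u x = v x ^ (-1 / (q - 1))) : 1 ≤ J.avg v * J.avg u ^ (q - 1) := by
  have hu0 : ∀ᵐ x, 0 < u x := by
    filter_upwards [hv0, huv] with x h1 h2
    rw [h2]; positivity
  have hx := J.avg_pos hv hv0
  have hy := J.avg_pos hu hu0
  have hl := J.len_pos
  have hq0 : 0 < q := by linarith
  have hq1 : 0 < q - 1 := by linarith
  -- C^q is the quantity to be bounded below. Since v^{1/q} u^{(q-1)/q} = 1, AM-GM for v and u
  -- divided by their averages gives an integrand of mean C.
  set C := J.avg v ^ (1 / q) * J.avg u ^ ((q - 1) / q) with hC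
  have hC0 : 0 < C := by positivity
  have hpt : ∀ᵐ z, 1 ≤ C * (1 / q * (v z / J.avg v) + (q - 1) / q * (u z / J.avg u)) := by
    filter_upwards [hv0, hu0, huv] with z h1 h2 h3
    have h := Real.geom_mean_le_arith_mean2_weighted (p₁ := v z / J.avg v) (p₂ := u z / J.avg u)
      (by positivity : 0 ≤ 1 / q) (by positivity : 0 ≤ (q - 1) / q) (by positivity)
      (by positivity) (by field_simp; ring)
    calc (1 : ℝ) = C * ((v z / J.avg v) ^ (1 / q) * (u z / J.avg u) ^ ((q - 1) / q)) := by
          rw [Real.div_rpow h1.le hx.le, Real.div_rpow h2.le hy.le, h3, ← Real.rpow_mul h1.le, hC]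
          have e : v z ^ (1 / q) * v z ^ (-1 / (q - 1) * ((q - 1) / q)) = 1 := by
            rw [← Real.rpow_add h1, show 1 / q + -1 / (q - 1) * ((q - 1) / q) = 0 by
              field_simp; ring, Real.rpow_zero]
          have := (Real.rpow_pos_of_pos hx (1 / q)).ne'
          have := (Real.rpow_pos_of_pos hy ((q - 1) / q)).ne'
          calc (1 : ℝ) = v z ^ (1 / q) * v z ^ (-1 / (q - 1) * ((q - 1) / q)) := e.symm
            _ = _ := by
              generalize v z ^ (-1 / (q - 1) * ((q - 1) / q)) = V
              field_simp
      _ ≤ _ := mul_le_mul_of_nonneg_left h hC0.le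
  have hint : J.len ≤ C * J.len := by
    have h1 : ∫ _ in J.toSet, (1 : ℝ) ≤
        ∫ z in J.toSet, C * (1 / q * (v z / J.avg v) + (q - 1) / q * (u z / J.avg u)) := by
      apply integral_mono_ae
      · exact integrableOn_const (by rw [volume_toSet]; exact ENNReal.ofReal_ne_top)
      · exact (((hv.div_const _).const_mul _).add ((hu.div_const _).const_mul _)).const_mul _
      · exact ae_restrict_of_ae hpt
    rw [integral_const_mul, integral_add ((hv.div_const _).const_mul _)
      ((hu.div_const _).const_mul _), integral_const_mul, integral_const_mul, integral_div,
      integral_div, ← len_mul_avg J v, ← len_mul_avg J u, setIntegral_const,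
      volume_real_toSet] at h1
    refine h1.trans (le_of_eq ?_) |>.trans' (by simp)
    field_simp
    ring
  have hC1 : 1 ≤ C := by
    by_contra! h
    nlinarith
  have e : C ^ q = J.avg v * J.avg u ^ (q - 1) := by
    rw [hC, Real.mul_rpow (by positivity) (by positivity), ← Real.rpow_mul hx.le,
      ← Real.rpow_mul hy.le, one_div_mul_cancel hq0.ne', Real.rpow_one,
      div_mul_cancel₀ _ hq0.ne']
  rw [← e]
  exact Real.one_le_rpow hC1 hq0.le

/-- The Cauchy-Schwarz inequality for averages. -/
theorem avg_mul_sq_le (J : DyadicInterval) {g r : ℝ → ℝ}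
    (hg : IntegrableOn (fun z => g z ^ 2) J.toSet) (hr : IntegrableOn (fun z => r z ^ 2) J.toSet)
    (hgr : IntegrableOn (fun z => g z * r z) J.toSet) (h0 : 0 < J.avg fun z => r z ^ 2) :
    (J.avg fun z => g z * r z) ^ 2 / (J.avg fun z => r z ^ 2) ≤ J.avg fun z => g z ^ 2 := by
  -- This c minimises the integral of (g - c r)².
  set c := (J.avg fun z => g z * r z) / (J.avg fun z => r z ^ 2) with hc
  have hl := J.len_pos
  have h : 0 ≤ ∫ z in J.toSet, (g z ^ 2 - 2 * c * (g z * r z) + c ^ 2 * r z ^ 2) := by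
    refine integral_nonneg fun z => ?_
    have : g z ^ 2 - 2 * c * (g z * r z) + c ^ 2 * r z ^ 2 = (g z - c * r z) ^ 2 := by ring
    change 0 ≤ g z ^ 2 - 2 * c * (g z * r z) + c ^ 2 * r z ^ 2
    rw [this]
    positivity
  have hsub : IntegrableOn (fun z => g z ^ 2 - 2 * c * (g z * r z)) J.toSet :=
    hg.sub (hgr.const_mul _)
  rw [integral_add hsub (hr.const_mul _), integral_sub hg (hgr.const_mul _),
    integral_const_mul, integral_const_mul, ← len_mul_avg, ← len_mul_avg, ← len_mul_avg] at h
  have h' : 0 ≤ J.len * ((J.avg fun z => g z ^ 2)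
      - (J.avg fun z => g z * r z) ^ 2 / (J.avg fun z => r z ^ 2)) := by
    refine h.trans (le_of_eq ?_)
    rw [hc]; field_simp; ring
  linarith [nonneg_of_mul_nonneg_right h' hl]

end DyadicInterval

/-! ### Telescoping and the weighted square function -/

open DyadicInterval

theorem sum_Ico_two_mul (f : ℤ → ℝ) (a : ℤ) (n : ℕ) :
    ∑ i ∈ Finset.Ico (2 * a) (2 * (a + n)), f i
      = ∑ i ∈ Finset.Ico a (a + n), (f (2 * i) + f (2 * i + 1)) := by
  induction n with
  | zero => simp
  | succ n ih =>
    have e1 : Finset.Ico a (a + (n + 1 : ℕ)) = insert (a + n) (Finset.Ico a (a + n)) := by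
      ext i; simp only [Finset.mem_Ico, Finset.mem_insert]; omega
    have e2 : Finset.Ico (2 * a) (2 * (a + (n + 1 : ℕ)))
        = insert (2 * (a + n) + 1) (insert (2 * (a + n)) (Finset.Ico (2 * a) (2 * (a + n)))) := by
      ext i; simp only [Finset.mem_Ico, Finset.mem_insert]; omega
    rw [e1, e2, Finset.sum_insert (by simp), Finset.sum_insert (by simp),
      Finset.sum_insert (by simp), ih]
    ring

/-- The telescoping argument of the Bellman function method. -/
theorem sum_le_of_superadditive {φ B : DyadicInterval → ℝ} {K : ℝ} (hφ : ∀ J, 0 ≤ φ J)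
    (hB : ∀ J, 0 ≤ B J) (h : ∀ J, φ J + B J.right + B J.left ≤ B J)
    (hK : ∀ (k : ℤ) (R : ℕ), ∑ i ∈ Finset.Ico (-R : ℤ) R, B ⟨k, i⟩ ≤ K)
    (F : Finset DyadicInterval) : ∑ J ∈ F, φ J ≤ K := by
  classical
  -- Induction on the number of scales: the children of the window [-R, R) fill exactly the window
  -- [-2R, 2R) one scale finer.
  have key : ∀ (N : ℕ) (k : ℤ) (R : ℕ) (F : Finset DyadicInterval),
      (∀ J ∈ F, k ≤ J.scale ∧ J.scale < k + N ∧ -R ≤ J.pos ∧ J.pos < R) →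
      ∑ J ∈ F, φ J ≤ ∑ i ∈ Finset.Ico (-R : ℤ) R, B ⟨k, i⟩ := by
    intro N
    induction N with
    | zero =>
      intro k R F hF
      have : F = ∅ := Finset.eq_empty_of_forall_notMem fun J hJ => by
        have := hF J hJ
        omega
      rw [this, Finset.sum_empty]
      exact Finset.sum_nonneg fun _ _ => hB _
    | succ N ih =>
      intro k R F hF
      have h1 : ∑ J ∈ F with J.scale ≠ k, φ J
          ≤ ∑ i ∈ Finset.Ico (-R : ℤ) R, (B (right ⟨k, i⟩) + B (left ⟨k, i⟩)) := by
        refine (ih (k + 1) (2 * R) _ fun J hJ => ?_).trans (le_of_eq ?_)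
        · obtain ⟨hJ, hJk⟩ := Finset.mem_filter.1 hJ
          have := hF J hJ
          push_cast at *
          omega
        · have := sum_Ico_two_mul (fun i => B ⟨k + 1, i⟩) (-R) (2 * R)
          have e1 : 2 * (-(R : ℤ)) = -((2 * R : ℕ) : ℤ) := by push_cast; ring
          have e2 : 2 * (-(R : ℤ) + (2 * R : ℕ)) = ((2 * R : ℕ) : ℤ) := by push_cast; ring
          have e3 : -(R : ℤ) + (2 * R : ℕ) = R := by push_cast; ring
          rw [e2, e1, e3] at this
          rw [this]
          exact Finset.sum_congr rfl fun i _ => add_comm _ _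
      have h2 : ∑ J ∈ F with J.scale = k, φ J ≤ ∑ i ∈ Finset.Ico (-R : ℤ) R, φ ⟨k, i⟩ := by
        let e : ℤ ↪ DyadicInterval := ⟨DyadicInterval.mk k, fun _ _ h => congrArg pos h⟩
        refine le_trans (Finset.sum_le_sum_of_subset_of_nonneg
          (t := (Finset.Ico (-R : ℤ) R).map e) ?_ fun J _ _ => hφ J) (le_of_eq (Finset.sum_map _ _ _))
        intro J hJ
        obtain ⟨hJ, hJk⟩ := Finset.mem_filter.1 hJ
        have := hF J hJ
        refine Finset.mem_map.2 ⟨J.pos, Finset.mem_Ico.2 ⟨this.2.2.1, this.2.2.2⟩, ?_⟩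
        exact DyadicInterval.ext hJk.symm rfl
      rw [← Finset.sum_filter_add_sum_filter_not F (fun J => J.scale = k)]
      refine (add_le_add h2 h1).trans ?_
      rw [← Finset.sum_add_distrib]
      exact Finset.sum_le_sum fun i _ => by linarith [h ⟨k, i⟩]
  -- One R bounds positions and scales strictly, so F lies in the 2R scales from -R on.
  set R : ℕ := ∑ J ∈ F, (J.pos.natAbs + J.scale.natAbs + 1) with hR
  have hle : ∀ J ∈ F, J.pos.natAbs + J.scale.natAbs + 1 ≤ R := fun J hJ =>
    Finset.single_le_sum (f := fun J : DyadicInterval => J.pos.natAbs + J.scale.natAbs + 1)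
      (fun _ _ => Nat.zero_le _) hJ
  refine (key (2 * R) (-R) R F fun J hJ => ?_).trans (hK _ _)
  have := hle J hJ
  push_cast
  omega

/-- The weighted square function estimate, for real functions. -/
theorem sum_sq_integral_mul_haar_le {q Q : ℝ} (hq : 1 < q) {r u g : ℝ → ℝ}
    (hr : ∀ J : DyadicInterval, MemLp r 2 (volume.restrict J.toSet)) (hr0 : ∀ᵐ z, 0 < r z)
    (hu : ∀ J : DyadicInterval, IntegrableOn u J.toSet)
    (hur : ∀ᵐ z, u z = (r z ^ 2) ^ (-1 / (q - 1)))
    (hA : ∀ J : DyadicInterval, (J.avg fun z => r z ^ 2) * J.avg u ^ (q - 1) ≤ Q)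
    (hg : MemLp g 2 volume) (F : Finset DyadicInterval) :
    ∑ J ∈ F, (∫ z, g z * (r z * haar J z)) ^ 2 / (J.avg fun z => r z ^ 2)
      ≤ 130 * (q + 1) * Q * ∫ z, g z ^ 2 := by
  have hv0 : ∀ᵐ z, 0 < r z ^ 2 := hr0.mono fun z hz => by positivity
  have hu0 : ∀ᵐ z, 0 < u z := by
    filter_upwards [hv0, hur] with z h1 h2
    rw [h2]; positivity
  have hv : ∀ J : DyadicInterval, IntegrableOn (fun z => r z ^ 2) J.toSet :=
    fun J => (hr J).integrable_sq
  have hg2 : Integrable fun z => g z ^ 2 := hg.integrable_sq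
  have hgr : ∀ J : DyadicInterval, IntegrableOn (fun z => g z * r z) J.toSet :=
    fun J => (hg.restrict J.toSet).integrable_mul (hr J)
  have hx : ∀ J : DyadicInterval, 0 < J.avg fun z => r z ^ 2 := fun J => J.avg_pos (hv J) hv0
  have hy : ∀ J : DyadicInterval, 0 < J.avg u := fun J => J.avg_pos (hu J) hu0
  have h1 : ∀ J : DyadicInterval, 1 ≤ (J.avg fun z => r z ^ 2) * J.avg u ^ (q - 1) :=
    fun J => J.one_le_avg_mul_avg_rpow hq (hv J) (hu J) hv0 hur
  have hQ1 : 1 ≤ Q := (h1 ⟨0, 0⟩).trans (hA _)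
  have hQ : 0 < Q := by linarith
  set x : DyadicInterval → ℝ := fun J => J.avg fun z => r z ^ 2
  set y : DyadicInterval → ℝ := fun J => J.avg u
  set G : DyadicInterval → ℝ := fun J => J.avg fun z => g z * r z with hG
  set X : DyadicInterval → ℝ := fun J => J.avg fun z => g z ^ 2 with hX
  set D : DyadicInterval → ℝ := fun J => bellmanDenom q Q (x J) (y J)
  set K : ℝ := 128 * (q + 1) * Q with hK
  have hK0 : 0 < K := by positivity
  have hx_eq : ∀ J, x J = (x J.right + x J.left) / 2 := fun J => J.avg_eq (hv J)
  have hy_eq : ∀ J, y J = (y J.right + y J.left) / 2 := fun J => J.avg_eq (hu J)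
  have hG_eq : ∀ J, G J = (G J.right + G J.left) / 2 := fun J => J.avg_eq (hgr J)
  have hX_eq : ∀ J, X J = (X J.right + X J.left) / 2 := fun J => J.avg_eq hg2.integrableOn
  have hGx : ∀ J, G J ^ 2 / x J ≤ X J := fun J =>
    J.avg_mul_sq_le hg2.integrableOn (hv J) (hgr J) (hx J)
  have hGD : ∀ J, G J ^ 2 / D J ≤ X J := fun J => by
    have := hx J
    refine le_trans ?_ (hGx J)
    gcongr
    exact le_bellmanDenom hQ (hx J) (hy J) (h1 J)
  have hD0 : ∀ J, 0 < D J := fun J => (hx J).trans_le (le_bellmanDenom hQ (hx J) (hy J) (h1 J))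
  have hCK : 2 + K ≤ 130 * (q + 1) * Q := by
    have : 1 ≤ (q + 1) * Q := by nlinarith
    rw [hK]; linarith
  -- By Cauchy-Schwarz X dominates both quotients, so the factor 2 + K makes B nonnegative. X itself
  -- averages exactly, so the gain comes from the two convex terms alone.
  refine sum_le_of_superadditive
    (B := fun J => J.len * ((2 + K) * X J - 2 * (G J ^ 2 / x J) - K * (G J ^ 2 / D J)))
    (fun J => div_nonneg (sq_nonneg _) (hx J).le) (fun J => ?_) (fun J => ?_) (fun k R => ?_) F
  · apply mul_nonneg J.len_pos.le
    linarith [hGx J, mul_le_mul_of_nonneg_left (hGD J) hK0.le]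
  · have hB := bellman_midpoint hq hQ (hx J.right) (hx J.left) (hy J.right) (hy J.left)
      (hG_eq J) (hx_eq J) (hy_eq J) (hA J) (h1 J) (h1 _) (h1 _)
    have e : (∫ z, g z * (r z * haar J z)) ^ 2 / x J
        = J.len * (((G J.right - G J.left) / 2) ^ 2 / x J) := by
      simp_rw [← mul_assoc]
      rw [J.integral_mul_haar (hgr J), mul_pow, Real.sq_sqrt J.len_pos.le, mul_div_assoc]
    change (∫ z, g z * (r z * haar J z)) ^ 2 / x J + _ + _ ≤ _
    rw [e, len_left, len_right]
    have hB' := mul_le_mul_of_nonneg_left hB J.len_pos.le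
    have hX' := hX_eq J
    refine le_of_sub_nonneg ((sub_nonneg.2 hB').trans (le_of_eq ?_))
    rw [hX', hK]
    ring
  · set S : Finset DyadicInterval := (Finset.Ico (-R : ℤ) R).map
      ⟨DyadicInterval.mk k, fun _ _ h => congrArg pos h⟩ with hS
    have hsum := sum_setIntegral_le (F := S) (k := k) (s := Set.univ) (f := fun z => g z ^ 2)
      (fun I hI => by obtain ⟨i, -, rfl⟩ := Finset.mem_map.1 hI; rfl)
      (fun _ _ => Set.subset_univ _) hg2.integrableOn (Filter.Eventually.of_forall fun z => sq_nonneg _)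
    rw [setIntegral_univ, hS, Finset.sum_map] at hsum
    have h0 : 0 ≤ ∫ z, g z ^ 2 := integral_nonneg fun z => sq_nonneg (g z)
    refine le_trans ?_ (mul_le_mul_of_nonneg_right hCK h0)
    refine le_trans ?_ (mul_le_mul_of_nonneg_left hsum (by positivity))
    rw [Finset.mul_sum]
    refine Finset.sum_le_sum fun i _ => ?_
    set J : DyadicInterval := ⟨k, i⟩
    change _ ≤ (2 + K) * ∫ z in J.toSet, g z ^ 2
    rw [← len_mul_avg, mul_left_comm]
    apply mul_le_mul_of_nonneg_left _ J.len_pos.le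
    have a1 : 0 ≤ G J ^ 2 / x J := div_nonneg (sq_nonneg _) (hx J).le
    have a2 : 0 ≤ K * (G J ^ 2 / D J) := mul_nonneg hK0.le (div_nonneg (sq_nonneg _) (hD0 J).le)
    change (2 + K) * X J - _ - _ ≤ (2 + K) * X J
    linarith

/-! ### Passage to complex L² -/

theorem memLp_mul_haar {r : ℝ → ℝ} (J : DyadicInterval)
    (hr : MemLp r 2 (volume.restrict J.toSet)) :
    MemLp (fun z => ((r z * haar J z : ℝ) : ℂ)) 2 volume := by
  have hR : MemLp (J.right.toSet.indicator r) 2 volume :=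
    (memLp_indicator_iff_restrict J.right.measurableSet_toSet).2
      (hr.mono_measure (Measure.restrict_mono (J.left_union_right ▸ Set.subset_union_right) le_rfl))
  have hL : MemLp (J.left.toSet.indicator r) 2 volume :=
    (memLp_indicator_iff_restrict J.left.measurableSet_toSet).2
      (hr.mono_measure (Measure.restrict_mono (J.left_union_right ▸ Set.subset_union_left) le_rfl))
  have h := ((hR.sub hL).const_mul (√J.len)⁻¹).ofReal (K := ℂ)
  convert h using 2 with z
  simp only [Pi.sub_apply, haar]
  congr 1
  by_cases h1 : z ∈ J.right.toSet <;> by_cases h2 : z ∈ J.left.toSet <;> simp [h1, h2] <;> ring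

/-- The function `r h_J` as an element of `L²`. -/
noncomputable def mulHaarLp (r : ℝ → ℝ)
    (hr : ∀ J : DyadicInterval, MemLp r 2 (volume.restrict J.toSet)) (J : DyadicInterval) :
    Lp ℂ 2 (volume : Measure ℝ) :=
  (memLp_mul_haar J (hr J)).toLp

open scoped InnerProductSpace in
theorem inner_mulHaarLp {r : ℝ → ℝ}
    (hr : ∀ J : DyadicInterval, MemLp r 2 (volume.restrict J.toSet)) (J : DyadicInterval)
    (f : Lp ℂ 2 (volume : Measure ℝ)) :
    ⟪mulHaarLp r hr J, f⟫_ℂ = ∫ z, f z * ((r z * haar J z : ℝ) : ℂ) := by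
  rw [L2.inner_def]
  refine integral_congr_ae ?_
  filter_upwards [(memLp_mul_haar J (hr J)).coeFn_toLp] with z hz
  rw [mulHaarLp, hz, RCLike.inner_apply, Complex.conj_ofReal]

open scoped InnerProductSpace in
/-- The weighted square function estimate on `L²(ℝ; ℂ)`. -/
theorem sum_norm_sq_inner_mulHaarLp_le {q Q : ℝ} (hq : 1 < q) {r u : ℝ → ℝ}
    (hr : ∀ J : DyadicInterval, MemLp r 2 (volume.restrict J.toSet)) (hr0 : ∀ᵐ z, 0 < r z)
    (hu : ∀ J : DyadicInterval, IntegrableOn u J.toSet)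
    (hur : ∀ᵐ z, u z = (r z ^ 2) ^ (-1 / (q - 1)))
    (hA : ∀ J : DyadicInterval, (J.avg fun z => r z ^ 2) * J.avg u ^ (q - 1) ≤ Q)
    (f : Lp ℂ 2 (volume : Measure ℝ)) (F : Finset DyadicInterval) :
    ∑ J ∈ F, ‖⟪mulHaarLp r hr J, f⟫_ℂ‖ ^ 2 / (J.avg fun z => r z ^ 2)
      ≤ 130 * (q + 1) * Q * ‖f‖ ^ 2 := by
  have hf : MemLp f 2 volume := Lp.memLp f
  have hre : MemLp (fun z => (f z).re) 2 volume := hf.re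
  have him : MemLp (fun z => (f z).im) 2 volume := hf.im
  have hnorm : ‖f‖ ^ 2 = (∫ z, (f z).re ^ 2) + ∫ z, (f z).im ^ 2 := by
    rw [← integral_add hre.integrable_sq him.integrable_sq]
    have h : ⟪f, f⟫_ℂ = ((∫ z, ((f z).re ^ 2 + (f z).im ^ 2) : ℝ) : ℂ) := by
      rw [L2.inner_def, ← integral_complex_ofReal]
      refine integral_congr_ae (Filter.Eventually.of_forall fun z => ?_)
      change ⟪f z, f z⟫_ℂ = (((f z).re ^ 2 + (f z).im ^ 2 : ℝ) : ℂ)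
      rw [RCLike.inner_apply, Complex.mul_conj, Complex.normSq_apply]
      push_cast; ring
    rw [inner_self_eq_norm_sq_to_K] at h
    refine Complex.ofReal_injective (Eq.trans ?_ h)
    push_cast
    rfl
  rw [hnorm, mul_add]
  refine le_trans (le_of_eq ?_) (add_le_add
    (sum_sq_integral_mul_haar_le hq hr hr0 hu hur hA hre F)
    (sum_sq_integral_mul_haar_le hq hr hr0 hu hur hA him F))
  rw [← Finset.sum_add_distrib]
  refine Finset.sum_congr rfl fun J _ => ?_
  have hint : Integrable fun z => f z * ((r z * haar J z : ℝ) : ℂ) :=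
    hf.integrable_mul (memLp_mul_haar J (hr J))
  rw [← add_div, inner_mulHaarLp, Complex.sq_norm, Complex.normSq_apply, ← sq, ← sq]
  have e1 : (∫ z, f z * ((r z * haar J z : ℝ) : ℂ)).re = ∫ z, (f z).re * (r z * haar J z) := by
    rw [← Complex.reCLM_apply, ← Complex.reCLM.integral_comp_comm hint]
    simp only [Complex.reCLM_apply, Complex.re_mul_ofReal]
  have e2 : (∫ z, f z * ((r z * haar J z : ℝ) : ℂ)).im = ∫ z, (f z).im * (r z * haar J z) := by
    rw [← Complex.imCLM_apply, ← Complex.imCLM.integral_comp_comm hint]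
    simp only [Complex.imCLM_apply, Complex.im_mul_ofReal]
  rw [e1, e2]

theorem toLp_finset_sum {ι : Type*} (s : Finset ι) {f : ι → ℝ → ℂ}
    (hf : ∀ i, MemLp (f i) 2 volume) (h : MemLp (fun x => ∑ i ∈ s, f i x) 2 volume) :
    h.toLp = ∑ i ∈ s, (hf i).toLp := by
  classical
  induction s using Finset.induction_on with
  | empty =>
    rw [Finset.sum_empty]
    exact MemLp.toLp_zero _
  | insert i s hi ih =>
    have hs : MemLp (fun x => ∑ i ∈ s, f i x) 2 volume := memLp_finsetSum s fun i _ => hf i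
    rw [Finset.sum_insert hi, ← ih hs, ← MemLp.toLp_add]
    congr 1
    funext x
    simp [Finset.sum_insert hi]

/-! ### Block sums and characteristics as real averages -/

theorem sum_descendants_le_one {v : ℝ → ℝ} (hv : ∀ J : DyadicInterval, IntegrableOn v J.toSet)
    (hv0 : ∀ᵐ z, 0 < v z) (n : ℕ) (L : DyadicInterval) :
    ∑ J ∈ L.descendants n, √(J.len / (L.len * L.avg v)) ^ 2 * J.avg v ≤ 1 := by
  have hL : 0 < L.len * L.avg v := mul_pos L.len_pos (L.avg_pos (hv L) hv0)
  have h := sum_setIntegral_le (F := L.descendants n) (s := L.toSet)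
    (fun I hI => scale_of_mem_descendants hI) (fun I hI => (mem_descendants.1 hI).1) (hv L)
    (hv0.mono fun z hz => hz.le)
  simp_rw [← len_mul_avg] at h
  calc _ = (∑ J ∈ L.descendants n, J.len * J.avg v) / (L.len * L.avg v) := by
        rw [Finset.sum_div]
        refine Finset.sum_congr rfl fun J _ => ?_
        rw [Real.sq_sqrt (div_nonneg J.len_pos.le hL.le)]
        ring
    _ ≤ 1 := (div_le_one hL).2 h

theorem integrableOn_toSet {f : ℝ → ℝ} (hf : LocallyIntegrable f volume) (J : DyadicInterval) :
    IntegrableOn f J.toSet :=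
  (hf.integrableOn_isCompact isCompact_Icc).mono_set Set.Ico_subset_Icc_self

theorem setAverage_eq_avg (J : DyadicInterval) (f : ℝ → ℝ) : ⨍ x in J.toSet, f x = J.avg f := by
  rw [setAverage_eq, volume_real_toSet, smul_eq_mul, avg, inv_mul_eq_div]

theorem setLAverage_ofReal (J : DyadicInterval) {f : ℝ → ℝ} (hf : IntegrableOn f J.toSet)
    (h0 : ∀ᵐ x, 0 < f x) :
    ⨍⁻ x in J.toSet, ENNReal.ofReal (f x) ∂volume = ENNReal.ofReal (J.avg f) := by
  rw [← setAverage_eq_avg, ofReal_setAverage hf (ae_restrict_of_ae (h0.mono fun x hx => hx.le)),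
    setLAverage_eq]

theorem avg_mul_avg_rpow_le_cChar {s : ℝ} {w : ℝ → ℝ} (hw : MemC s w) (J : DyadicInterval)
    (hs : IntegrableOn (fun x => w x ^ s) J.toSet) :
    (J.avg fun x => w x ^ s) * J.avg w ^ (-s) ≤ (cChar s w).toReal := by
  have hwJ := integrableOn_toSet hw.1.1 J
  have h0 := hw.1.2
  have hs0 : ∀ᵐ x, 0 < w x ^ s := h0.mono fun x hx => by positivity
  have h := le_iSup (fun I : DyadicInterval =>
    (⨍⁻ x in I.toSet, ENNReal.ofReal (w x ^ s) ∂volume) *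
      (⨍⁻ x in I.toSet, ENNReal.ofReal (w x) ∂volume) ^ (-s)) J
  simp only [setLAverage_ofReal J hs hs0, setLAverage_ofReal J hwJ h0] at h
  rw [ENNReal.ofReal_rpow_of_pos (J.avg_pos hwJ h0),
    ← ENNReal.ofReal_mul (J.avg_pos hs hs0).le] at h
  exact (ENNReal.ofReal_le_iff_le_toReal hw.2.ne).1 h

/-- Since m_J v > 0, a finite product in [0, ∞] forces the dual average to be finite. Without this
the real integral would take its default value 0. -/
theorem MemA.integrableOn_dual {q : ℝ} (hq : 1 < q) {v : ℝ → ℝ} (hv : MemA q v)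
    (J : DyadicInterval) : IntegrableOn (fun x => v x ^ (-1 / (q - 1))) J.toSet := by
  have hvJ := integrableOn_toSet hv.1.1 J
  have h0 := hv.1.2
  have h := (le_iSup (fun I : DyadicInterval =>
    (⨍⁻ x in I.toSet, ENNReal.ofReal (v x) ∂volume) *
      (⨍⁻ x in I.toSet, ENNReal.ofReal (v x ^ (-1 / (q - 1))) ∂volume) ^ (q - 1)) J).trans_lt hv.2
  rw [setLAverage_ofReal J hvJ h0] at h
  have hne : ENNReal.ofReal (J.avg v) ≠ 0 := (ENNReal.ofReal_pos.2 (J.avg_pos hvJ h0)).ne'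
  have hlt := ENNReal.lt_top_of_mul_ne_top_right h.ne hne
  rw [ENNReal.rpow_lt_top_iff_of_pos (by linarith), setLAverage_eq] at hlt
  refine ⟨(hvJ.aestronglyMeasurable.aemeasurable.pow_const _).aestronglyMeasurable, ?_⟩
  rw [hasFiniteIntegral_iff_ofReal
    (ae_restrict_of_ae (h0.mono fun x hx => (Real.rpow_pos_of_pos hx _).le))]
  by_contra htop
  rw [not_lt, top_le_iff] at htop
  rw [htop, ENNReal.top_div_of_ne_top (by rw [volume_toSet]; exact ENNReal.ofReal_ne_top)] at hlt
  exact lt_irrefl _ hlt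

theorem avg_mul_avg_rpow_le_aChar {q : ℝ} (hq : 1 < q) {v : ℝ → ℝ} (hv : MemA q v)
    (J : DyadicInterval) :
    J.avg v * (J.avg fun x => v x ^ (-1 / (q - 1))) ^ (q - 1) ≤ (aChar q v).toReal := by
  have hvJ := integrableOn_toSet hv.1.1 J
  have huJ := hv.integrableOn_dual hq J
  have h0 := hv.1.2
  have hu0 : ∀ᵐ x, 0 < v x ^ (-1 / (q - 1)) := h0.mono fun x hx => by positivity
  have h := le_iSup (fun I : DyadicInterval =>
    (⨍⁻ x in I.toSet, ENNReal.ofReal (v x) ∂volume) *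
      (⨍⁻ x in I.toSet, ENNReal.ofReal (v x ^ (-1 / (q - 1))) ∂volume) ^ (q - 1)) J
  simp only [setLAverage_ofReal J hvJ h0, setLAverage_ofReal J huJ hu0] at h
  rw [ENNReal.ofReal_rpow_of_pos (J.avg_pos huJ hu0),
    ← ENNReal.ofReal_mul (J.avg_pos hvJ h0).le] at h
  exact (ENNReal.ofReal_le_iff_le_toReal hv.2.ne).1 h

/-! ### Assembling the multiplier -/

open scoped InnerProductSpace in
-- Attaching w^t to h_J leaves constant coefficients, so the block takes the finite rank form
-- required by `exists_hasSum_of_bessel`.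
theorem haarBlock_eq_sum {t : ℝ} {w : ℝ → ℝ}
    (h1 : ∀ J : DyadicInterval, MemLp (fun _ => (1 : ℝ)) 2 (volume.restrict J.toSet))
    (hr : ∀ J : DyadicInterval, MemLp (fun x => w x ^ t) 2 (volume.restrict J.toSet))
    (m n : ℕ) (L : DyadicInterval) (f : Lp ℂ 2 (volume : Measure ℝ)) :
    ∃ h : MemLp (haarBlock t w m n L f) 2 volume,
      h.toLp = ∑ I ∈ L.descendants m, ∑ J ∈ L.descendants n,
        (((√(I.len * J.len) / L.len * (L.avg w ^ t)⁻¹ : ℝ) : ℂ) *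
          ⟪mulHaarLp (fun _ => 1) h1 I, f⟫_ℂ) • mulHaarLp (fun x => w x ^ t) hr J := by
  have hterm : ∀ p : DyadicInterval × DyadicInterval,
      MemLp ((((√(p.1.len * p.2.len) / L.len * (L.avg w ^ t)⁻¹ : ℝ) : ℂ) *
        ⟪mulHaarLp (fun _ => 1) h1 p.1, f⟫_ℂ) • fun z => ((w z ^ t * haar p.2 z : ℝ) : ℂ))
        2 volume := fun p => (memLp_mul_haar p.2 (hr p.2)).const_smul _
  have heq : haarBlock t w m n L f = fun x => ∑ p ∈ L.descendants m ×ˢ L.descendants n,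
      ((((√(p.1.len * p.2.len) / L.len * (L.avg w ^ t)⁻¹ : ℝ) : ℂ) *
        ⟪mulHaarLp (fun _ => 1) h1 p.1, f⟫_ℂ) • fun z => ((w z ^ t * haar p.2 z : ℝ) : ℂ)) x := by
    funext x
    rw [haarBlock, Finset.sum_product]
    refine Finset.sum_congr rfl fun I _ => Finset.sum_congr rfl fun J _ => ?_
    rw [inner_mulHaarLp, setAverage_eq_avg, Pi.smul_apply, smul_eq_mul]
    simp only [one_mul]
    push_cast
    ring
  have hmem : MemLp (haarBlock t w m n L f) 2 volume := by
    rw [heq]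
    exact memLp_finsetSum _ fun p _ => hterm p
  refine ⟨hmem, ?_⟩
  have e : hmem.toLp = (memLp_finsetSum (L.descendants m ×ˢ L.descendants n)
      fun p _ => hterm p).toLp := MemLp.toLp_congr _ _ (by rw [heq])
  rw [e, toLp_finset_sum _ hterm, Finset.sum_product]
  rfl

/-- The size of the coefficients of the Haar multiplier. -/
theorem abs_coeff_le {i j l m x c t : ℝ} (hi : 0 < i) (hj : 0 < j) (hl : 0 < l) (hm : 0 < m)
    (hx : 0 < x) (h : x * m ^ (-(2 * t)) ≤ c) :
    |√(i * j) / l * (m ^ t)⁻¹| ≤ √c * (√(i / l) * √(j / (l * x))) := by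
  have hc : 0 ≤ c := le_trans (by positivity) h
  rw [abs_of_nonneg (by positivity), ← Real.sqrt_mul (by positivity), ← Real.sqrt_mul hc]
  apply Real.le_sqrt_of_sq_le
  have e : ((m ^ t)⁻¹) ^ 2 = m ^ (-(2 * t)) := by
    rw [← Real.rpow_neg hm.le, ← Real.rpow_natCast, ← Real.rpow_mul hm.le]
    congr 1
    push_cast
    ring
  rw [mul_pow, div_pow, Real.sq_sqrt (by positivity), e]
  have h' : m ^ (-(2 * t)) ≤ c / x := by rw [le_div_iff₀ hx, mul_comm]; exact h
  calc i * j / l ^ 2 * m ^ (-(2 * t)) ≤ i * j / l ^ 2 * (c / x) := by gcongr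
    _ = _ := by field_simp

open scoped InnerProductSpace in
theorem exists_isHaarMultiplier {q : ℝ} (hq : 1 < q) {t : ℝ} {w : ℝ → ℝ} (hC : MemC (2 * t) w)
    (hA : MemA q fun x => w x ^ (2 * t)) (m n : ℕ) :
    ∃ T : Lp ℂ 2 (volume : Measure ℝ) →L[ℂ] Lp ℂ 2 (volume : Measure ℝ),
      IsHaarMultiplier t w m n T ∧
      ‖T‖ ≤ √(cChar (2 * t) w).toReal * √390 *
        √(130 * (q + 1) * (aChar q fun x => w x ^ (2 * t)).toReal) := by
  have hw0 := hC.1.2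
  have hw := fun J => integrableOn_toSet hC.1.1 J
  have hv := fun J => integrableOn_toSet hA.1.1 J
  have h1 : ∀ J : DyadicInterval, MemLp (fun _ => (1 : ℝ)) 2 (volume.restrict J.toSet) := by
    intro J
    have : IsFiniteMeasure (volume.restrict J.toSet) :=
      ⟨by rw [Measure.restrict_apply_univ, volume_toSet]; exact ENNReal.ofReal_lt_top⟩
    exact memLp_const 1
  have hint1 : ∀ J : DyadicInterval, IntegrableOn (fun _ => (1 : ℝ)) J.toSet := fun J =>
    integrableOn_const (by rw [volume_toSet]; exact ENNReal.ofReal_ne_top)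
  have havg1 : ∀ J : DyadicInterval, (J.avg fun _ => (1 : ℝ)) = 1 := by
    intro J
    rw [avg, setIntegral_const, volume_real_toSet, smul_eq_mul, mul_one, div_self J.len_pos.ne']
  have hsq : ∀ᵐ x, (w x ^ t) ^ 2 = w x ^ (2 * t) := by
    filter_upwards [hw0] with x hx
    rw [← Real.rpow_natCast, ← Real.rpow_mul hx.le, mul_comm]
    norm_num
  have hr : ∀ J : DyadicInterval, MemLp (fun x => w x ^ t) 2 (volume.restrict J.toSet) := by
    intro J
    rw [memLp_two_iff_integrable_sq
      ((hw J).aestronglyMeasurable.aemeasurable.pow_const t).aestronglyMeasurable]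
    exact (hv J).congr (ae_restrict_of_ae (hsq.mono fun x hx => hx.symm))
  have havg : ∀ J : DyadicInterval,
      (J.avg fun x => (w x ^ t) ^ 2) = J.avg fun x => w x ^ (2 * t) := by
    intro J
    unfold avg
    rw [integral_congr_ae (ae_restrict_of_ae hsq)]
  have hx : ∀ J : DyadicInterval, 0 < J.avg fun x => w x ^ (2 * t) :=
    fun J => J.avg_pos (hv J) hA.1.2
  -- The constant weight with q = 2 and Q = 1 gives a Bessel inequality for the Haar system with
  -- constant 130 · 3 = 390.
  have hφ := sum_norm_sq_inner_mulHaarLp_le (q := 2) (Q := 1) (by norm_num) h1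
    (Filter.Eventually.of_forall fun _ => one_pos) (u := fun _ => 1) hint1
    (Filter.Eventually.of_forall fun _ => by norm_num)
    (fun J => by norm_num [havg1])
  have hψ := sum_norm_sq_inner_mulHaarLp_le hq hr (hw0.mono fun x hx => by positivity)
    (fun J => hA.integrableOn_dual hq J) (hsq.mono fun x hx => by rw [hx])
    (fun J => by rw [havg]; exact avg_mul_avg_rpow_le_aChar hq hA J)
  simp only [havg] at hψ
  simp only [one_pow, havg1, div_one] at hφ
  obtain ⟨T, hT, hTn⟩ := exists_hasSum_of_bessel (x := fun J => J.avg fun x => w x ^ (2 * t)) hx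
    (pairwise_disjoint_descendants m) (pairwise_disjoint_descendants n)
    (c := fun L I J => √(I.len * J.len) / L.len * (L.avg w ^ t)⁻¹)
    (α := fun L I => √(I.len / L.len))
    (β := fun L J => √(J.len / (L.len * L.avg fun x => w x ^ (2 * t))))
    (Real.sqrt_nonneg (cChar (2 * t) w).toReal)
    (fun L I _ J _ => abs_coeff_le I.len_pos J.len_pos L.len_pos (L.avg_pos (hw L) hw0) (hx L)
      (avg_mul_avg_rpow_le_cChar hC L (hv L)))
    (fun L => by
      simpa [havg1] using sum_descendants_le_one hint1
        (Filter.Eventually.of_forall fun _ => one_pos) m L)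
    (fun L => sum_descendants_le_one hv hA.1.2 n L)
    (by norm_num) (mul_nonneg (by linarith) ENNReal.toReal_nonneg) hφ hψ
  refine ⟨T, fun f => ?_, hTn.trans (le_of_eq (by norm_num))⟩
  choose hmem hLp using fun L => haarBlock_eq_sum h1 hr m n L f
  refine ⟨hmem, ?_⟩
  simp only [hLp]
  exact hT f

end DyadicHaar

theorem theorem1 (q : ℝ) (hq : 1 < q) :
    ∃ C : ℝ, 0 < C ∧
      ∀ (t : ℝ) (w : ℝ → ℝ), DyadicHaar.MemC (2 * t) w →
        DyadicHaar.MemA q (fun x => w x ^ (2 * t)) →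
        ∀ m n : ℕ,
          ∃ T : MeasureTheory.Lp ℂ 2 (MeasureTheory.volume : MeasureTheory.Measure ℝ) →L[ℂ]
              MeasureTheory.Lp ℂ 2 (MeasureTheory.volume : MeasureTheory.Measure ℝ),
            DyadicHaar.IsHaarMultiplier t w m n T ∧
            ‖T‖ ≤ C * ((m : ℝ) + n + 2) ^ 3 *
              (DyadicHaar.cChar (2 * t) w).toReal ^ (1 / 2 : ℝ) *
              (DyadicHaar.aChar q (fun x => w x ^ (2 * t))).toReal ^ (1 / 2 : ℝ) := by
  have hq0 : 0 < q + 1 := by linarith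
  refine ⟨√390 * √(130 * (q + 1)), by positivity, fun t w hC hA m n => ?_⟩
  obtain ⟨T, hT, hTn⟩ := DyadicHaar.exists_isHaarMultiplier hq hC hA m n
  refine ⟨T, hT, hTn.trans ?_⟩
  rw [← Real.sqrt_eq_rpow, ← Real.sqrt_eq_rpow, Real.sqrt_mul (by positivity)]
  -- The bound already holds without the complexity factor, which is inserted only because it is at
  -- least 1.
  have hmn : (1 : ℝ) ≤ ((m : ℝ) + n + 2) ^ 3 := one_le_pow₀ (by
    have : (0 : ℝ) ≤ m := Nat.cast_nonneg m
    have : (0 : ℝ) ≤ n := Nat.cast_nonneg n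
    linarith)
  set c := √(DyadicHaar.cChar (2 * t) w).toReal
  set a := √(DyadicHaar.aChar q (fun x => w x ^ (2 * t))).toReal
  calc c * √390 * (√(130 * (q + 1)) * a) = √390 * √(130 * (q + 1)) * 1 * c * a := by ring
    _ ≤ √390 * √(130 * (q + 1)) * ((m : ℝ) + n + 2) ^ 3 * c * a := by gcongr
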